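/- Let $(\mathbb{A},+)$ be a compact metrizable abelian topological group, let $h$ be its Haar probability measure (the unique shift-invariant Borel probability measure), and let $\mathcal{M}$ be the space of Borel probability measures on $\mathbb{A}$ with the weak-* topology. A measure $\mu\in\mathcal{M}$ is called strictly aperiodic if the smallest semigroup containing $\{\alpha-\beta : \alpha,\beta\in\operatorname{supp}(\mu)\}$ is dense in $\mathbb{A}$, where $\operatorname{supp}(\mu)$ is the topological support of $\mu$. Let $K\subset\mathcal{M}$ be compact (in the weak-* topology) and such that every $\mu\in K$ is strictly aperiodic, and let $\mu_1,\mu_2,\mu_3,\ldots$ be a sequence of measures in $K$. Let $\varphi:\mathbb{A}\to\mathbb{R}$ be continuous. (1) For every $x\in\mathbb{A}$ and all independent random elements $\alpha_1,\alpha_2,\ldots$ of $\mathbb{A}$ such that $\alpha_j$ has distribution $\mu_j$ for every $j$, almost surely $$\frac1n\sum_{k=0}^{n-1}\varphi(x+\alpha_1+\alpha_2+\cdots+\alpha_k)\longrightarrow\int_{\mathbb{A}}\varphi\,dh\qquad\text{as } n\to\infty .$$ (2) For every $\varepsilon>0$ there exist $C,\delta>0$ such that for every $x\in\mathbb{A}$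 and every $n\ge1$ $$\mathbb{P}\left(\left|\frac1n\sum_{k=0}^{n-1}\varphi(x+\alpha_1+\alpha_2+\cdots+\alpha_k)-\int_{\mathbb{A}}\varphi\,dh\right|>\varepsilon\right)<C\exp(-\delta n),$$ where $\mathbb{P}=\prod_{n=1}^{\infty}\mu_n$ is the law of the sequence $(\alpha_1,\alpha_2,\ldots)$ on $\mathbb{A}^{\mathbb{N}}$. -/

import Mathlib

open MeasureTheory ProbabilityTheory Filter Topology

namespace NonstationaryWalk

/-- A Borel measure `μ` on a topological abelian group (viewed as a random shift) is
*strictly aperiodic* if the smallest semigroup containing all differences `α - β` with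
`α, β ∈ supp μ` is dense. -/
def StrictlyAperiodic {A : Type*} [AddCommGroup A] [TopologicalSpace A] [MeasurableSpace A]
    (μ : Measure A) : Prop :=
  Dense (AddSubsemigroup.closure {g : A | ∃ α ∈ μ.support, ∃ β ∈ μ.support, g = α - β} : Set A)

/-- The Haar measure of a compact abelian group, normalized to have total mass one. -/
noncomputable def haarProb (A : Type*) [AddCommGroup A] [TopologicalSpace A]
    [IsTopologicalAddGroup A] [CompactSpace A] [MeasurableSpace A] [BorelSpace A] : Measure A :=
  Measure.addHaarMeasure (⊤ : TopologicalSpace.PositiveCompacts A)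

/-- `haarProb` is a probability measure. -/
instance instIsProbabilityMeasureHaarProb (A : Type*) [AddCommGroup A] [TopologicalSpace A]
    [IsTopologicalAddGroup A] [CompactSpace A] [MeasurableSpace A] [BorelSpace A] :
    IsProbabilityMeasure (haarProb A) :=
  ⟨by simpa [haarProb] using
    Measure.addHaarMeasure_self (K₀ := (⊤ : TopologicalSpace.PositiveCompacts A))⟩

/-- The average `(1/n) ∑_{k=0}^{n-1} φ(x + a₁ + ⋯ + aₖ)` along the walk started at `x` with steps
`a₁, a₂, …`; the step `a_{j+1}` is the entry `a j` of the sequence `a`. -/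
noncomputable def walkAverage {A : Type*} [AddCommGroup A] (φ : A → ℝ) (x : A) (a : ℕ → A)
    (n : ℕ) : ℝ :=
  (1 / (n : ℝ)) * ∑ k ∈ Finset.range n, φ (x + ∑ j ∈ Finset.range k, a j)

end NonstationaryWalk

open MeasureTheory ProbabilityTheory Filter Topology

set_option linter.unusedSectionVars false

namespace NonstationaryWalk

/-! ### Averaging operators on continuous functions. -/

section Operator

variable {A : Type*} [AddCommGroup A] [TopologicalSpace A] [IsTopologicalAddGroup A]
  [CompactSpace A] [MeasurableSpace A] [BorelSpace A]

/-! Averaging over a step is a contraction of `C(A, ℝ)`, and it lowers the Haar `L²` energy by the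
mean variance over the step. For a strictly aperiodic law this drop is positive on nonzero mean-zero
functions (`energy_avg_lt`). All iterated averages of `φ` lie in one compact set
(`isCompact_modulusSet`), so compactness makes the drop uniform over `K`: some `N` averages make a
centered `φ` uniformly small, whatever laws in `K` are used (`exists_iterAvg_norm_lt`).

Summing the first `N` iterates gives bounded correctors `g k` with `φ = g k - avg (ν k) (g (k + 1))`
up to a small error. Along the walk, the sum of `φ` is then a bounded boundary term, a martingale
with bounded increments and a small multiple of `n` (`sum_eq_mart_add`). An Azuma–Hoeffding bound
(`integral_exp_mart_le`) gives the exponential tail, and Borel–Cantelli the almost sure limit. -/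

lemma integrable_continuousMap {X : Type*} [TopologicalSpace X] [CompactSpace X]
    [MeasurableSpace X] [BorelSpace X] (ν : Measure X) [IsFiniteMeasure ν] (f : C(X, ℝ)) :
    Integrable f ν :=
  f.continuous.integrable_of_hasCompactSupport (HasCompactSupport.of_compactSpace _)

lemma abs_integral_le_norm {X : Type*} [TopologicalSpace X] [CompactSpace X]
    [MeasurableSpace X] (ν : Measure X) [IsProbabilityMeasure ν]
    (f : C(X, ℝ)) : |∫ y, f y ∂ν| ≤ ‖f‖ := by
  have := norm_integral_le_of_norm_le_const (μ := ν) (f := f) (C := ‖f‖)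
    (Eventually.of_forall f.norm_coe_le_norm)
  simpa using this

lemma lipschitzWith_integral {X : Type*} [TopologicalSpace X] [CompactSpace X]
    [MeasurableSpace X] [BorelSpace X] (ν : Measure X) [IsProbabilityMeasure ν] :
    LipschitzWith 1 fun f : C(X, ℝ) => ∫ y, f y ∂ν := by
  refine LipschitzWith.of_dist_le_mul (K := 1) fun f g => ?_
  rw [Real.dist_eq, ← integral_sub (integrable_continuousMap ν f) (integrable_continuousMap ν g)]
  simpa [dist_eq_norm] using abs_integral_le_norm ν (f - g)

/-- Joint continuity holds because the pairing is 1-Lipschitz in the function, uniformly in the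
measure. It is needed for compactness over pairs (law, function). -/
lemma continuous_integral_pairing :
    Continuous fun p : ProbabilityMeasure A × C(A, ℝ) => ∫ y, p.2 y ∂(p.1 : Measure A) := by
  refine continuous_prod_of_continuous_lipschitzWith' _ 1 (fun ν => ?_) fun f =>
    ProbabilityMeasure.continuous_integral_boundedContinuousFunction
      (BoundedContinuousFunction.mkOfCompact f)
  exact lipschitzWith_integral (ν : Measure A)

lemma continuous_translate :
    Continuous fun p : C(A, ℝ) × A => p.1.comp (ContinuousMap.addLeft p.2) := by
  refine ContinuousMap.continuous_of_continuous_uncurry _ ?_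
  change Continuous fun q : (C(A, ℝ) × A) × A => q.1.1 (q.1.2 + q.2)
  fun_prop

/-- The averaging operator `f ↦ (x ↦ ∫ f (x + y) dν(y))`. -/
noncomputable def avg (ν : ProbabilityMeasure A) : C(A, ℝ) →ₗ[ℝ] C(A, ℝ) where
  toFun f := ⟨fun x => ∫ y, f (x + y) ∂(ν : Measure A),
    continuous_integral_pairing.comp (continuous_const.prodMk
      (continuous_translate.comp (continuous_const.prodMk continuous_id)) :
        Continuous fun x => (ν, f.comp (ContinuousMap.addLeft x)))⟩
  map_add' f g := by
    ext x
    exact integral_add (integrable_continuousMap _ (f.comp (ContinuousMap.addLeft x)))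
      (integrable_continuousMap _ (g.comp (ContinuousMap.addLeft x)))
  map_smul' c f := by
    ext x
    exact integral_const_mul c _

lemma avg_apply (ν : ProbabilityMeasure A) (f : C(A, ℝ)) (x : A) :
    avg ν f x = ∫ y, f (x + y) ∂(ν : Measure A) := rfl

lemma continuous_avg :
    Continuous fun p : ProbabilityMeasure A × C(A, ℝ) => avg p.1 p.2 := by
  refine ContinuousMap.continuous_of_continuous_uncurry _ ?_
  exact continuous_integral_pairing.comp
    ((continuous_fst.comp continuous_fst).prodMk (continuous_translate.comp
      ((continuous_snd.comp continuous_fst).prodMk continuous_snd)) :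
      Continuous fun q : (ProbabilityMeasure A × C(A, ℝ)) × A =>
        (q.1.1, q.1.2.comp (ContinuousMap.addLeft q.2)))

lemma norm_avg_le (ν : ProbabilityMeasure A) (f : C(A, ℝ)) : ‖avg ν f‖ ≤ ‖f‖ := by
  refine (ContinuousMap.norm_le _ (norm_nonneg _)).2 fun x => ?_
  refine (abs_integral_le_norm (ν : Measure A) (f.comp (ContinuousMap.addLeft x))).trans ?_
  exact (ContinuousMap.norm_le _ (norm_nonneg _)).2 fun y => f.norm_coe_le_norm _

/-! ### Haar invariance and the loss of energy under averaging. -/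

instance : (haarProb A).IsAddHaarMeasure := by unfold haarProb; infer_instance

lemma integral_avg (ν : ProbabilityMeasure A) (f : C(A, ℝ)) :
    ∫ x, avg ν f x ∂(haarProb A) = ∫ x, f x ∂(haarProb A) := by
  simp only [avg_apply]
  rw [integral_integral_swap_of_hasCompactSupport (f := fun x y => f (x + y)) (by
    change Continuous fun q : A × A => f (q.1 + q.2)
    fun_prop) (HasCompactSupport.of_compactSpace _)]
  simp [integral_add_right_eq_self (μ := haarProb A) f]

/-- The squared `L²` norm with respect to Haar measure. -/
noncomputable def energy (f : C(A, ℝ)) : ℝ := ∫ x, (f * f) x ∂(haarProb A)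

lemma continuous_energy : Continuous (energy (A := A)) :=
  (lipschitzWith_integral (haarProb A)).continuous.comp (continuous_id.mul continuous_id)

lemma energy_nonneg (f : C(A, ℝ)) : 0 ≤ energy f :=
  integral_nonneg fun x => mul_self_nonneg (f x)

lemma energy_zero : energy (0 : C(A, ℝ)) = 0 := by simp [energy]

lemma eq_zero_of_integral_eq_zero {f : C(A, ℝ)} (hf : ∀ x, 0 ≤ f x)
    (h : ∫ x, f x ∂(haarProb A) = 0) : ∀ x, f x = 0 := by
  rw [integral_eq_zero_iff_of_nonneg hf (integrable_continuousMap _ f)] at h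
  exact congrFun ((f.continuous.ae_eq_iff_eq (haarProb A) continuous_zero).1 h)

lemma eq_zero_of_energy_eq_zero {f : C(A, ℝ)} (h : energy f = 0) : f = 0 := by
  ext x
  exact mul_self_eq_zero.1 (eq_zero_of_integral_eq_zero (f := f * f)
    (fun x => mul_self_nonneg (f x)) h x)

/-- The variance of `f (x + ·)` under `ν`, as a continuous function of `x`. -/
noncomputable def localVar (ν : ProbabilityMeasure A) (f : C(A, ℝ)) : C(A, ℝ) :=
  avg ν (f * f) - avg ν f * avg ν f

lemma localVar_apply (ν : ProbabilityMeasure A) (f : C(A, ℝ)) (x : A) :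
    localVar ν f x = ∫ y, (f (x + y) - avg ν f x) ^ 2 ∂(ν : Measure A) := by
  set c := avg ν f x with hc
  set g : C(A, ℝ) := f.comp (ContinuousMap.addLeft x) with hg
  have h1 : ∀ y, (f (x + y) - c) ^ 2 = (g * g) y - 2 * c * g y + c ^ 2 := fun y => by
    change _ = f (x + y) * f (x + y) - 2 * c * f (x + y) + c ^ 2
    ring
  have h2 : ∫ y, g y ∂(ν : Measure A) = c := rfl
  have h3 : ∫ y, (g * g) y ∂(ν : Measure A) = avg ν (f * f) x := rfl
  simp only [h1]
  have hi1 := integrable_continuousMap (ν : Measure A) (g * g)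
  have hi2 : Integrable (fun y => 2 * c * g y) (ν : Measure A) :=
    (integrable_continuousMap (ν : Measure A) g).const_mul _
  have hi3 : Integrable (fun y => (g * g) y - 2 * c * g y) (ν : Measure A) := hi1.sub hi2
  rw [integral_add hi3 (integrable_const _), integral_sub hi1 hi2, integral_const_mul, h2, h3]
  simp only [localVar, ContinuousMap.sub_apply, ContinuousMap.mul_apply, ← hc,
    integral_const, probReal_univ, smul_eq_mul]
  ring

lemma localVar_nonneg (ν : ProbabilityMeasure A) (f : C(A, ℝ)) (x : A) :
    0 ≤ localVar ν f x := by
  rw [localVar_apply]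
  exact integral_nonneg fun y => sq_nonneg _

/-- Averaging preserves the Haar integral of `f * f`, so the drop is exactly the mean local
variance. -/
lemma energy_sub_energy_avg (ν : ProbabilityMeasure A) (f : C(A, ℝ)) :
    energy f - energy (avg ν f) = ∫ x, localVar ν f x ∂(haarProb A) := by
  have : ∀ x, localVar ν f x = avg ν (f * f) x - (avg ν f * avg ν f) x := fun x => rfl
  simp only [this]
  rw [integral_sub (integrable_continuousMap _ _) (integrable_continuousMap _ _), integral_avg]
  rfl

lemma energy_avg_le (ν : ProbabilityMeasure A) (f : C(A, ℝ)) :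
    energy (avg ν f) ≤ energy f := by
  have h : 0 ≤ ∫ x, localVar ν f x ∂(haarProb A) := integral_nonneg (localVar_nonneg ν f)
  linarith [energy_sub_energy_avg ν f]

lemma eq_on_support_of_localVar_eq_zero {ν : ProbabilityMeasure A} {f : C(A, ℝ)} {x : A}
    (h : localVar ν f x = 0) {α : A} (hα : α ∈ (ν : Measure A).support) :
    f (x + α) = avg ν f x := by
  let g : C(A, ℝ) := (f.comp (ContinuousMap.addLeft x) - ContinuousMap.const A (avg ν f x)) ^ 2
  have hg : Integrable (fun y => (f (x + y) - avg ν f x) ^ 2) (ν : Measure A) :=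
    integrable_continuousMap _ g
  rw [localVar_apply, integral_eq_zero_iff_of_nonneg (fun y => sq_nonneg _) hg] at h
  have hcl : IsClosed {y | f (x + y) = avg ν f x} :=
    isClosed_eq (by fun_prop) continuous_const
  refine Measure.support_subset_of_isClosed hcl ?_ hα
  filter_upwards [h] with y hy
  exact sub_eq_zero.1 (pow_eq_zero_iff two_ne_zero |>.1 hy)

/-- Without loss every local variance vanishes, so `f (x + ·)` is constant on the support and each
difference of support points is a period of `f`. The periods form a closed subsemigroup, here dense,
so `f` is constant, hence zero. -/
lemma energy_avg_lt {ν : ProbabilityMeasure A} (hν : StrictlyAperiodic (ν : Measure A))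
    {f : C(A, ℝ)} (hf : ∫ x, f x ∂(haarProb A) = 0) (hne : f ≠ 0) :
    energy (avg ν f) < energy f := by
  refine (energy_avg_le ν f).lt_of_ne fun heq => hne ?_
  have hvar : ∀ x, localVar ν f x = 0 := eq_zero_of_integral_eq_zero (localVar_nonneg ν f)
    (by rw [← energy_sub_energy_avg, heq, sub_self])
  let S : AddSubsemigroup A :=
    { carrier := {g | ∀ x, f (x + g) = f x}
      add_mem' := fun {a b} ha hb x => by rw [← add_assoc, hb, ha] }
  have hS : IsClosed (S : Set A) := by
    change IsClosed {g | ∀ x, f (x + g) = f x}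
    simp only [Set.ofPred_forall]
    exact isClosed_iInter fun x => isClosed_eq (by fun_prop) continuous_const
  have hle : AddSubsemigroup.closure
      {g : A | ∃ α ∈ (ν : Measure A).support, ∃ β ∈ (ν : Measure A).support, g = α - β} ≤ S := by
    rw [AddSubsemigroup.closure_le]
    rintro _ ⟨α, hα, β, hβ, rfl⟩ x
    have h1 := eq_on_support_of_localVar_eq_zero (hvar (x - β)) hα
    have h2 := eq_on_support_of_localVar_eq_zero (hvar (x - β)) hβ
    rw [sub_add_cancel] at h2
    rw [h2, ← h1]
    congr 1
    abel
  have hmem : ∀ g, g ∈ S := fun g =>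
    closure_minimal (SetLike.coe_subset_coe.2 hle) hS (hν g)
  have hconst : ∀ x, f x = f 0 := fun x => by simpa using hmem x 0
  simp only [hconst, integral_const, probReal_univ, one_smul] at hf
  ext x
  rw [hconst, hf, ContinuousMap.zero_apply]

/-! ### A compact set stable under averaging. -/

/-- The continuous functions bounded by `‖φ‖` whose oscillation between two points is at most the
supremum distance between the corresponding translates of `φ`. -/
def modulusSet (φ : C(A, ℝ)) : Set C(A, ℝ) :=
  {f | (∀ x, |f x| ≤ ‖φ‖) ∧
    ∀ x y r, (∀ z, |φ (x + z) - φ (y + z)| ≤ r) → |f x - f y| ≤ r}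

lemma self_mem_modulusSet (φ : C(A, ℝ)) : φ ∈ modulusSet φ :=
  ⟨φ.norm_coe_le_norm, fun x y r h => by simpa using h 0⟩

lemma avg_mem_modulusSet {φ f : C(A, ℝ)} (ν : ProbabilityMeasure A) (hf : f ∈ modulusSet φ) :
    avg ν f ∈ modulusSet φ := by
  refine ⟨fun x => ?_, fun x y r h => ?_⟩
  · have := norm_integral_le_of_norm_le_const (μ := (ν : Measure A)) (f := fun y => f (x + y))
      (C := ‖φ‖) (Eventually.of_forall fun y => hf.1 _)
    simpa [avg_apply] using this
  · have := norm_integral_le_of_norm_le_const (μ := (ν : Measure A))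
      (f := fun z => f (x + z) - f (y + z)) (C := r)
      (Eventually.of_forall fun z => hf.2 _ _ _ fun w => by simpa [add_assoc] using h (z + w))
    have hint : ∀ x, Integrable (fun z => f (x + z)) (ν : Measure A) := fun x =>
      integrable_continuousMap _ (f.comp (ContinuousMap.addLeft x))
    rw [integral_sub (hint x) (hint y)] at this
    simpa [avg_apply] using this

lemma eventually_translate_near (φ : C(A, ℝ)) (x : A) {r : ℝ} (hr : 0 < r) :
    ∀ᶠ y in 𝓝 x, ∀ z, |φ (x + z) - φ (y + z)| ≤ r := by
  have hc : Continuous fun y : A => φ.comp (ContinuousMap.addLeft y) :=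
    continuous_translate.comp (continuous_const.prodMk continuous_id)
  filter_upwards [Metric.tendsto_nhds.1 (hc.tendsto x) r hr] with y hy z
  have := (ContinuousMap.dist_apply_le_dist (f := φ.comp (ContinuousMap.addLeft y))
    (g := φ.comp (ContinuousMap.addLeft x)) z).trans hy.le
  rw [dist_comm] at this
  exact this

/-- Arzelà–Ascoli: the modulus of `φ` gives equicontinuity, and Tychonoff gives pointwise
compactness. -/
lemma isCompact_modulusSet (φ : C(A, ℝ)) : IsCompact (modulusSet φ) := by
  refine ArzelaAscoli.isCompact_of_equicontinuous _ ?_ ?_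
  -- The inequalities already force continuity, so the image is cut out by pointwise closed
  -- conditions.
  · have himg : ContinuousMap.toFun '' modulusSet φ = {f : A → ℝ | (∀ x, |f x| ≤ ‖φ‖) ∧
        ∀ x y r, (∀ z, |φ (x + z) - φ (y + z)| ≤ r) → |f x - f y| ≤ r} := by
      ext f
      constructor
      · rintro ⟨g, hg, rfl⟩
        exact hg
      · intro hf
        refine ⟨⟨f, continuous_iff_continuousAt.2 fun x => ?_⟩, hf, rfl⟩
        refine Metric.tendsto_nhds.2 fun r hr => ?_
        filter_upwards [eventually_translate_near φ x (half_pos hr)] with y hy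
        rw [dist_comm]
        exact (hf.2 x y _ hy).trans_lt (half_lt_self hr)
    rw [himg]
    refine (isCompact_univ_pi fun _ : A => isCompact_Icc (a := -‖φ‖) (b := ‖φ‖)).of_isClosed_subset
      ?_ fun f hf x _ => abs_le.1 (hf.1 x)
    simp only [Set.ofPred_and, Set.ofPred_forall]
    refine (isClosed_iInter fun x => isClosed_le (by fun_prop) continuous_const).inter
      (isClosed_iInter fun x => isClosed_iInter fun y => isClosed_iInter fun r =>
        isClosed_iInter fun _ => isClosed_le (by fun_prop) continuous_const)
  · intro x
    rw [Metric.equicontinuousAt_iff_right]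
    intro r hr
    filter_upwards [eventually_translate_near φ x (half_pos hr)] with y hy f
    exact (f.2.2 x y _ hy).trans_lt (half_lt_self hr)

/-! ### Uniform decay of iterated averages, and correctors. -/

/-- `iterAvg ν n = avg (ν 0) ∘ ⋯ ∘ avg (ν (n - 1))`. -/
noncomputable def iterAvg : (ℕ → ProbabilityMeasure A) → ℕ → C(A, ℝ) → C(A, ℝ)
  | _, 0, f => f
  | ν, n + 1, f => avg (ν 0) (iterAvg (fun j => ν (j + 1)) n f)

lemma norm_iterAvg_le (ν : ℕ → ProbabilityMeasure A) (n : ℕ) (f : C(A, ℝ)) :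
    ‖iterAvg ν n f‖ ≤ ‖f‖ := by
  induction n generalizing ν with
  | zero => exact le_rfl
  | succ n ih => exact (norm_avg_le _ _).trans (ih _)

lemma exists_iterAvg_norm_lt {K : Set (ProbabilityMeasure A)} (hK : IsCompact K)
    (hK_ap : ∀ ν ∈ K, StrictlyAperiodic (ν : Measure A)) {φ : C(A, ℝ)}
    (hφ : ∫ x, φ x ∂(haarProb A) = 0) {ε : ℝ} (hε : 0 < ε) :
    ∃ N : ℕ, ∀ ν : ℕ → ProbabilityMeasure A, (∀ j, ν j ∈ K) → ‖iterAvg ν N φ‖ < ε := by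
  set Q : Set C(A, ℝ) := modulusSet φ ∩ {f | ∫ x, f x ∂(haarProb A) = 0} with hQ
  have hQc : IsCompact Q := (isCompact_modulusSet φ).inter_right
    (isClosed_eq ((lipschitzWith_integral _).continuous) continuous_const)
  have hQavg : ∀ ν f, f ∈ Q → avg ν f ∈ Q := fun ν f hf =>
    ⟨avg_mem_modulusSet ν hf.1, (integral_avg ν f).trans hf.2⟩
  have hQiter : ∀ n ν, iterAvg ν n φ ∈ Q := fun n => by
    induction n with
    | zero => exact fun _ => ⟨self_mem_modulusSet φ, hφ⟩
    | succ n ih => exact fun ν => hQavg _ _ (ih _)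
  -- On the compact `Q`, energy below `η` forces sup norm below `ε`.
  obtain ⟨η, hη, hη'⟩ : ∃ η > 0, ∀ f ∈ Q ∩ {f | ε ≤ ‖f‖}, η ≤ energy f := by
    refine (hQc.inter_right (isClosed_le continuous_const continuous_norm)).exists_forall_le'
      continuous_energy.continuousOn fun f hf => (energy_nonneg f).lt_of_ne fun h => ?_
    have h0 := eq_zero_of_energy_eq_zero h.symm
    have h1 : ε ≤ ‖f‖ := hf.2
    rw [h0, norm_zero] at h1
    exact hε.not_ge h1
  obtain ⟨c, hc, hc'⟩ : ∃ c > 0, ∀ p ∈ K ×ˢ (Q ∩ {f | η ≤ energy f}),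
      c ≤ energy p.2 - energy (avg p.1 p.2) := by
    refine (hK.prod (hQc.inter_right
      (isClosed_le continuous_const continuous_energy))).exists_forall_le'
      ((continuous_energy.comp continuous_snd).sub
        (continuous_energy.comp continuous_avg)).continuousOn fun p hp => ?_
    refine sub_pos.2 (energy_avg_lt (hK_ap _ hp.1) hp.2.1.2 fun h => ?_)
    have h1 : η ≤ energy p.2 := hp.2.2
    rw [h, energy_zero] at h1
    exact hη.not_ge h1
  -- Each average costs at least `c` until the energy is below `η`, where it stays. Since `ν 0` acts
  -- last, the induction runs over shifted sequences.
  have hdecay : ∀ n : ℕ, ∀ ν : ℕ → ProbabilityMeasure A, (∀ j, ν j ∈ K) →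
      energy (iterAvg ν n φ) < η ∨ energy (iterAvg ν n φ) ≤ energy φ - n * c := fun n => by
    induction n with
    | zero => exact fun ν _ => Or.inr (by simp [iterAvg])
    | succ n ih =>
      intro ν hν
      have hle := energy_avg_le (ν 0) (iterAvg (fun j => ν (j + 1)) n φ)
      rcases lt_or_ge (energy (iterAvg (fun j => ν (j + 1)) n φ)) η with h | h
      · exact Or.inl (hle.trans_lt h)
      · have h1 := (ih _ fun j => hν (j + 1)).resolve_left h.not_gt
        have h2 := hc' (ν 0, iterAvg (fun j => ν (j + 1)) n φ) ⟨hν 0, hQiter _ _, h⟩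
        refine Or.inr ?_
        simp only [iterAvg] at h2 ⊢
        push_cast
        linarith
  obtain ⟨N, hN⟩ := exists_nat_gt (energy φ / c)
  refine ⟨N, fun ν hν => not_le.1 fun h => ?_⟩
  have h1 := hη' _ ⟨hQiter N ν, h⟩
  have h2 := (hdecay N ν hν).resolve_left h1.not_gt
  rw [div_lt_iff₀ hc] at hN
  linarith

/-- A finite approximation of the solution of the nonstationary Poisson equation. -/
noncomputable def corrector (ν : ℕ → ProbabilityMeasure A) (φ : C(A, ℝ)) (N k : ℕ) : C(A, ℝ) :=
  ∑ i ∈ Finset.range N, iterAvg (fun j => ν (k + j)) i φ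

lemma norm_corrector_le (ν : ℕ → ProbabilityMeasure A) (φ : C(A, ℝ)) (N k : ℕ) :
    ‖corrector ν φ N k‖ ≤ N * ‖φ‖ := by
  simpa [corrector] using norm_sum_le_of_le (Finset.range N) fun i _ =>
    norm_iterAvg_le (fun j => ν (k + j)) i φ

/-- Both sides are the sum of iterates `0, …, N`: the left splits off the last, the right the
zeroth. -/
lemma corrector_add_iterAvg (ν : ℕ → ProbabilityMeasure A) (φ : C(A, ℝ)) (N k : ℕ) :
    corrector ν φ N k + iterAvg (fun j => ν (k + j)) N φ
      = φ + avg (ν k) (corrector ν φ N (k + 1)) := by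
  rw [corrector, ← Finset.sum_range_succ, Finset.sum_range_succ', corrector, map_sum, add_comm]
  simp only [iterAvg, add_zero, add_assoc, add_comm 1]

end Operator

/-! ### Martingale decomposition and exponential concentration. -/

section Concentration

variable {A : Type*} [AddCommGroup A] [TopologicalSpace A] [IsTopologicalAddGroup A]
  [CompactSpace A] [SecondCountableTopology A] [MeasurableSpace A] [BorelSpace A]

/-- The position of the walk started at `x` after `k` steps. -/
def pos (x : A) (a : ℕ → A) (k : ℕ) : A := x + ∑ j ∈ Finset.range k, a j

lemma pos_succ (x : A) (a : ℕ → A) (k : ℕ) : pos x a (k + 1) = pos x a k + a k := by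
  rw [pos, Finset.sum_range_succ, ← add_assoc, pos]

lemma pos_congr (x : A) {a b : ℕ → A} {k : ℕ} (h : ∀ j < k, a j = b j) :
    pos x a k = pos x b k := by
  rw [pos, pos, Finset.sum_congr rfl fun j hj => h j (Finset.mem_range.1 hj)]

lemma measurable_pos (x : A) (k : ℕ) : Measurable fun a : ℕ → A => pos x a k := by
  unfold pos
  fun_prop

/-- The martingale part of `g k (pos x a k)` along the walk. -/
noncomputable def mart (ν : ℕ → ProbabilityMeasure A) (g : ℕ → C(A, ℝ)) (x : A) (a : ℕ → A)
    (n : ℕ) : ℝ :=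
  ∑ k ∈ Finset.range n, (g (k + 1) (pos x a (k + 1)) - avg (ν k) (g (k + 1)) (pos x a k))

lemma mart_congr (ν : ℕ → ProbabilityMeasure A) (g : ℕ → C(A, ℝ)) (x : A) {a b : ℕ → A} {n : ℕ}
    (h : ∀ j < n, a j = b j) : mart ν g x a n = mart ν g x b n := by
  refine Finset.sum_congr rfl fun k hk => ?_
  have hk := Finset.mem_range.1 hk
  rw [pos_congr x (k := k + 1) fun j hj => h j (by omega),
    pos_congr x (k := k) fun j hj => h j (by omega)]

lemma measurable_mart (ν : ℕ → ProbabilityMeasure A) (g : ℕ → C(A, ℝ)) (x : A) (n : ℕ) :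
    Measurable fun a : ℕ → A => mart ν g x a n :=
  Finset.measurable_fun_sum _ fun k _ =>
    ((g (k + 1)).continuous.measurable.comp (measurable_pos x (k + 1))).sub
      ((avg (ν k) (g (k + 1))).continuous.measurable.comp (measurable_pos x k))

lemma abs_mart_le (ν : ℕ → ProbabilityMeasure A) {g : ℕ → C(A, ℝ)} {B : ℝ}
    (hB : ∀ k, ‖g k‖ ≤ B) (x : A) (a : ℕ → A) (n : ℕ) : |mart ν g x a n| ≤ n * (2 * B) := by
  have := norm_sum_le_of_le (Finset.range n) (f := fun k =>
    g (k + 1) (pos x a (k + 1)) - avg (ν k) (g (k + 1)) (pos x a k)) (n := fun _ => 2 * B)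
    fun k _ => by
      have h1 := ((g (k + 1)).norm_coe_le_norm (pos x a (k + 1))).trans (hB _)
      have h2 := ((avg (ν k) (g (k + 1))).norm_coe_le_norm (pos x a k)).trans
        ((norm_avg_le _ _).trans (hB _))
      exact (norm_sub_le _ _).trans (by linarith)
  simpa [mart] using this

/-- Hoeffding's lemma for a variable with values in `[-B, B]`. -/
lemma integral_exp_sub_avg_le (ν : ProbabilityMeasure A) {g : C(A, ℝ)} {B : ℝ} (hB : ‖g‖ ≤ B)
    (t : ℝ) (x : A) :
    ∫ y, Real.exp (t * (g (x + y) - avg ν g x)) ∂(ν : Measure A)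
      ≤ Real.exp (B ^ 2 * t ^ 2 / 2) := by
  have hB0 : 0 ≤ B := (norm_nonneg _).trans hB
  have hm : AEMeasurable (fun y => g (x + y)) (ν : Measure A) := by
    have : Continuous fun y => g (x + y) := by fun_prop
    exact this.measurable.aemeasurable
  have h := (hasSubgaussianMGF_of_mem_Icc hm (a := -B) (b := B)
    (Eventually.of_forall fun y => abs_le.1 ((g.norm_coe_le_norm _).trans hB))).mgf_le t
  refine h.trans_eq ?_
  congr 3
  push_cast
  rw [Real.norm_of_nonneg (by linarith)]
  ring

variable {Ω : Type*} [MeasurableSpace Ω] {P : Measure Ω} [IsProbabilityMeasure P]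
  {α : ℕ → Ω → A} {ν : ℕ → ProbabilityMeasure A}

lemma integrable_exp_mart (hα : ∀ j, Measurable (α j)) {g : ℕ → C(A, ℝ)} {B : ℝ}
    (hB : ∀ k, ‖g k‖ ≤ B) (t : ℝ) (x : A) (n : ℕ) :
    Integrable (fun ω => Real.exp (t * mart ν g x (fun j => α j ω) n)) P :=
  integrable_exp_mul_of_mem_Icc
    ((measurable_mart ν g x n).comp (measurable_pi_lambda _ hα)).aemeasurable
    (Eventually.of_forall fun _ => abs_le.1 (abs_mart_le ν hB x _ n))

lemma indepFun_mart_pos (hα : ∀ j, Measurable (α j)) (hind : iIndepFun α P) (g : ℕ → C(A, ℝ))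
    (x : A) (n : ℕ) :
    IndepFun (fun ω => (mart ν g x (fun j => α j ω) n, pos x (fun j => α j ω) n)) (α n) P := by
  -- Padding the first `n` steps by zeros exhibits the pair as a function of that finite block.
  let ext : (Finset.range n → A) → ℕ → A := fun b j =>
    if h : j ∈ Finset.range n then b ⟨j, h⟩ else 0
  have hext : Measurable ext := measurable_pi_lambda _ fun j => by
    by_cases h : j ∈ Finset.range n
    · simpa only [ext, h, dif_pos] using measurable_pi_apply _
    · simpa only [ext, h, dif_neg, not_false_eq_true] using measurable_const
  have h := (hind.indepFun_finset (Finset.range n) {n} (by simp) hα).comp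
    (((measurable_mart ν g x n).comp hext).prodMk ((measurable_pos x n).comp hext))
    (measurable_pi_apply ⟨n, Finset.mem_singleton_self n⟩)
  refine (congrArg (fun ξ => IndepFun ξ (α n) P) (funext fun ω => ?_)).mpr h
  have hagree : ∀ j < n, α j ω = ext (fun i : Finset.range n => α i ω) j := fun j hj => by
    simp [ext, hj]
  exact Prod.ext (mart_congr ν g x hagree) (pos_congr x hagree)

/-- Azuma–Hoeffding, with Fubini in place of conditioning: step `n` is independent of the past, so
integrating it out first costs one Hoeffding factor. -/
lemma integral_exp_mart_le (hα : ∀ j, Measurable (α j))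
    (hlaw : ∀ j, P.map (α j) = (ν j : Measure A)) (hind : iIndepFun α P) {g : ℕ → C(A, ℝ)} {B : ℝ}
    (hB : ∀ k, ‖g k‖ ≤ B) (t : ℝ) (x : A) (n : ℕ) :
    ∫ ω, Real.exp (t * mart ν g x (fun j => α j ω) n) ∂P
      ≤ Real.exp (n * (B ^ 2 * t ^ 2 / 2)) := by
  induction n with
  | zero => simp [mart]
  | succ n ih =>
    set ξ : Ω → ℝ × A := fun ω => (mart ν g x (fun j => α j ω) n, pos x (fun j => α j ω) n) with hξ
    have hα' : Measurable fun ω => fun j => α j ω := measurable_pi_lambda _ hα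
    have hξm : Measurable ξ :=
      ((measurable_mart ν g x n).comp hα').prodMk ((measurable_pos x n).comp hα')
    let F : (ℝ × A) × A → ℝ := fun q =>
      Real.exp (t * (q.1.1 + (g (n + 1) (q.1.2 + q.2) - avg (ν n) (g (n + 1)) q.1.2)))
    have hF : Measurable F := by
      have : Continuous F := by fun_prop
      exact this.measurable
    have hFξ : ∀ ω, F (ξ ω, α n ω) = Real.exp (t * mart ν g x (fun j => α j ω) (n + 1)) :=
      fun ω => by
        change _ = Real.exp (t * ∑ k ∈ Finset.range (n + 1), _)
        rw [Finset.sum_range_succ, pos_succ]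
        rfl
    have hmap : P.map (fun ω => (ξ ω, α n ω)) = (P.map ξ).prod (ν n : Measure A) := by
      rw [← hlaw n]
      exact (indepFun_iff_map_prod_eq_prod_map_map hξm.aemeasurable (hα n).aemeasurable).1
        (indepFun_mart_pos hα hind g x n)
    have hpm : AEMeasurable (fun ω => (ξ ω, α n ω)) P := (hξm.prodMk (hα n)).aemeasurable
    have : IsProbabilityMeasure (P.map ξ) := Measure.isProbabilityMeasure_map hξm.aemeasurable
    have hFint : Integrable F ((P.map ξ).prod (ν n : Measure A)) := by
      rw [← hmap, integrable_map_measure hF.aestronglyMeasurable hpm]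
      exact (integrable_exp_mart (ν := ν) hα hB t x (n + 1)).congr
        (Eventually.of_forall fun ω => (hFξ ω).symm)
    have hEint : Integrable (fun q : ℝ × A => Real.exp (t * q.1)) (P.map ξ) := by
      rw [integrable_map_measure (by fun_prop) hξm.aemeasurable]
      exact integrable_exp_mart hα hB t x n
    calc ∫ ω, Real.exp (t * mart ν g x (fun j => α j ω) (n + 1)) ∂P
        = ∫ q, ∫ y, F (q, y) ∂(ν n : Measure A) ∂(P.map ξ) := by
          simp only [← hFξ]
          rw [← integral_map hpm hF.aestronglyMeasurable, hmap, integral_prod _ hFint]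
      _ ≤ ∫ q, Real.exp (B ^ 2 * t ^ 2 / 2) * Real.exp (t * q.1) ∂(P.map ξ) := by
          refine integral_mono hFint.integral_prod_left (hEint.const_mul _) fun q => ?_
          simp only [F, mul_add t q.1, Real.exp_add]
          rw [integral_const_mul, mul_comm]
          exact mul_le_mul_of_nonneg_right (integral_exp_sub_avg_le (ν n) (hB _) t q.2)
            (Real.exp_pos _).le
      _ = Real.exp (B ^ 2 * t ^ 2 / 2) * ∫ ω, Real.exp (t * mart ν g x (fun j => α j ω) n) ∂P := by
          rw [integral_const_mul, integral_map hξm.aemeasurable (by fun_prop)]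
      _ ≤ Real.exp (B ^ 2 * t ^ 2 / 2) * Real.exp (n * (B ^ 2 * t ^ 2 / 2)) := by gcongr
      _ = Real.exp ((n + 1 : ℕ) * (B ^ 2 * t ^ 2 / 2)) := by
          rw [← Real.exp_add]
          push_cast
          ring_nf

lemma sum_eq_mart_add (ν : ℕ → ProbabilityMeasure A) (φ : C(A, ℝ)) (N : ℕ) (x : A) (a : ℕ → A)
    (n : ℕ) :
    ∑ k ∈ Finset.range n, φ (pos x a k) =
      corrector ν φ N 0 (pos x a 0) - corrector ν φ N n (pos x a n)
        + mart ν (corrector ν φ N) x a n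
        + ∑ k ∈ Finset.range n, iterAvg (fun j => ν (k + j)) N φ (pos x a k) := by
  induction n with
  | zero => simp [mart]
  | succ n ih =>
    have h := DFunLike.congr_fun (corrector_add_iterAvg ν φ N n) (pos x a n)
    simp only [ContinuousMap.add_apply] at h
    rw [Finset.sum_range_succ, ih, Finset.sum_range_succ, mart, mart, Finset.sum_range_succ]
    linarith

lemma abs_sum_le_abs_mart_add {φ : C(A, ℝ)} {N : ℕ} {B r : ℝ}
    (hB : ∀ k, ‖corrector ν φ N k‖ ≤ B) (hr : ∀ k, ‖iterAvg (fun j => ν (k + j)) N φ‖ ≤ r)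
    (x : A) (a : ℕ → A) (n : ℕ) :
    |∑ k ∈ Finset.range n, φ (pos x a k)|
      ≤ |mart ν (corrector ν φ N) x a n| + 2 * B + n * r := by
  have h1 := abs_le.1 (((corrector ν φ N 0).norm_coe_le_norm (pos x a 0)).trans (hB 0))
  have h2 := abs_le.1 (((corrector ν φ N n).norm_coe_le_norm (pos x a n)).trans (hB n))
  have h3 : |∑ k ∈ Finset.range n, iterAvg (fun j => ν (k + j)) N φ (pos x a k)| ≤ n * r := by
    simpa using norm_sum_le_of_le (Finset.range n) fun k _ =>
      ((iterAvg (fun j => ν (k + j)) N φ).norm_coe_le_norm (pos x a k)).trans (hr k)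
  rw [sum_eq_mart_add ν φ N]
  have h3 := abs_le.1 h3
  have h4 := le_abs_self (mart ν (corrector ν φ N) x a n)
  have h5 := neg_abs_le (mart ν (corrector ν φ N) x a n)
  exact abs_le.2 ⟨by linarith, by linarith⟩

lemma exists_exp_tail_of_integral_eq_zero {K : Set (ProbabilityMeasure A)} (hK : IsCompact K)
    (hK_ap : ∀ ν ∈ K, StrictlyAperiodic (ν : Measure A)) (hν : ∀ j, ν j ∈ K)
    (hα : ∀ j, Measurable (α j)) (hlaw : ∀ j, P.map (α j) = (ν j : Measure A))
    (hind : iIndepFun α P) {φ : C(A, ℝ)} (hφ : ∫ x, φ x ∂(haarProb A) = 0) {ε : ℝ} (hε : 0 < ε) :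
    ∃ C δ : ℝ, 0 < C ∧ 0 < δ ∧ ∀ (x : A) (n : ℕ),
      P.real {ω | n * ε < |∑ k ∈ Finset.range n, φ (pos x (fun j => α j ω) k)|}
        ≤ C * Real.exp (-δ * n) := by
  obtain ⟨N, hN⟩ := exists_iterAvg_norm_lt hK hK_ap hφ (half_pos hε)
  -- The `+ 1` keeps `B` positive, so that dividing by it is legitimate.
  set B : ℝ := N * ‖φ‖ + 1 with hBdef
  have hBpos : 0 < B := by positivity
  have hB : ∀ k, ‖corrector ν φ N k‖ ≤ B := fun k =>
    (norm_corrector_le ν φ N k).trans (by linarith)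
  have hr : ∀ k, ‖iterAvg (fun j => ν (k + j)) N φ‖ ≤ ε / 2 := fun k =>
    (hN _ fun j => hν (k + j)).le
  refine ⟨2 * Real.exp (ε / B), ε ^ 2 / (8 * B ^ 2), by positivity, by positivity, fun x n => ?_⟩
  set M : Ω → ℝ := fun ω => mart ν (corrector ν φ N) x (fun j => α j ω) n with hM
  -- `s` is what remains for the martingale after the error `n * (ε / 2)` and the boundary term `2 *
  -- B`. `t` minimizes `-t * n * (ε / 2) + n * B ^ 2 * t ^ 2 / 2`; the boundary term leaves the
  -- factor `exp (ε / B)`.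
  set s : ℝ := n * (ε / 2) - 2 * B with hs
  set t : ℝ := ε / (2 * B ^ 2) with ht
  have ht0 : 0 ≤ t := by positivity
  have hexp : ∀ u, u ^ 2 = t ^ 2 →
      Real.exp (-t * s) * mgf M P u ≤ Real.exp (ε / B) * Real.exp (-(ε ^ 2 / (8 * B ^ 2)) * n) := by
    intro u hu
    have h1 := integral_exp_mart_le hα hlaw hind hB u x n
    rw [hu] at h1
    refine (mul_le_mul_of_nonneg_left h1 (Real.exp_pos _).le).trans_eq ?_
    rw [← Real.exp_add, ← Real.exp_add]
    congr 1
    rw [hs, ht]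
    field_simp
    ring
  have hup := (measure_ge_le_exp_mul_mgf s ht0
    (integrable_exp_mart (P := P) (ν := ν) hα hB t x n)).trans (hexp t rfl)
  have hlo := measure_le_le_exp_mul_mgf (-s) (neg_nonpos.2 ht0)
    (integrable_exp_mart (P := P) (ν := ν) hα hB (-t) x n)
  rw [neg_neg, mul_neg, ← neg_mul] at hlo
  have hlo := hlo.trans (hexp (-t) (neg_sq t))
  have hsub : {ω | n * ε < |∑ k ∈ Finset.range n, φ (pos x (fun j => α j ω) k)|}
      ⊆ {ω | s ≤ M ω} ∪ {ω | M ω ≤ -s} := fun ω hω => by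
    have h1 : n * ε < |∑ k ∈ Finset.range n, φ (pos x (fun j => α j ω) k)| := hω
    have h2 := abs_sum_le_abs_mart_add hB hr x (fun j => α j ω) n
    have h3 : s ≤ |M ω| := by linarith
    exact (le_abs'.1 h3).symm
  refine (measureReal_mono hsub).trans ((measureReal_union_le _ _).trans ?_)
  linarith

end Concentration

/-! ### Tail bounds for the averages and almost sure convergence. -/

section LargeDeviations

variable {A : Type*} [AddCommGroup A] [TopologicalSpace A] [IsTopologicalAddGroup A]
  [CompactSpace A] [SecondCountableTopology A] [MeasurableSpace A] [BorelSpace A]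
  {Ω : Type*} [MeasurableSpace Ω] {P : Measure Ω} [IsProbabilityMeasure P]
  {α : ℕ → Ω → A} {ν : ℕ → ProbabilityMeasure A}

lemma exists_exp_tail {K : Set (ProbabilityMeasure A)} (hK : IsCompact K)
    (hK_ap : ∀ ν ∈ K, StrictlyAperiodic (ν : Measure A)) (hν : ∀ j, ν j ∈ K)
    (hα : ∀ j, Measurable (α j)) (hlaw : ∀ j, P.map (α j) = (ν j : Measure A))
    (hind : iIndepFun α P) (φ : C(A, ℝ)) {ε : ℝ} (hε : 0 < ε) :
    ∃ C δ : ℝ, 0 < C ∧ 0 < δ ∧ ∀ (x : A) (n : ℕ), 1 ≤ n →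
      P.real {ω | ε < |walkAverage φ x (fun j => α j ω) n - ∫ y, φ y ∂(haarProb A)|}
        ≤ C * Real.exp (-δ * n) := by
  set c := ∫ y, φ y ∂(haarProb A) with hc
  have hφ : ∫ y, (φ - ContinuousMap.const A c) y ∂(haarProb A) = 0 := by
    change ∫ y, (φ y - c) ∂(haarProb A) = 0
    rw [integral_sub (integrable_continuousMap _ φ) (integrable_const _)]
    simp [← hc]
  obtain ⟨C, δ, hC, hδ, h⟩ :=
    exists_exp_tail_of_integral_eq_zero hK hK_ap hν hα hlaw hind hφ hε
  refine ⟨C, δ, hC, hδ, fun x n hn => (measureReal_mono fun ω hω => ?_).trans (h x n)⟩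
  have hn0 : (0 : ℝ) < n := by exact_mod_cast hn
  have hω : ε < |walkAverage φ x (fun j => α j ω) n - c| := hω
  have hsum : ∑ k ∈ Finset.range n, (φ - ContinuousMap.const A c) (pos x (fun j => α j ω) k)
      = n * (walkAverage φ x (fun j => α j ω) n - c) := by
    change ∑ k ∈ Finset.range n, (φ (pos x (fun j => α j ω) k) - c) = _
    rw [Finset.sum_sub_distrib, walkAverage]
    simp only [pos, Finset.sum_const, Finset.card_range, nsmul_eq_mul]
    field_simp
  change n * ε < |∑ k ∈ Finset.range n, (φ - ContinuousMap.const A c) _|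
  rw [hsum, abs_mul, abs_of_pos hn0]
  exact mul_lt_mul_of_pos_left hω hn0

/-- The tails are summable, so Borel–Cantelli applies at each level `1 / (m + 1)`; countably many
levels suffice. -/
lemma ae_tendsto_of_exp_tail {Y : ℕ → Ω → ℝ}
    (h : ∀ ε : ℝ, 0 < ε → ∃ C δ : ℝ, 0 < C ∧ 0 < δ ∧ ∀ n : ℕ, 1 ≤ n →
      P.real {ω | ε < |Y n ω|} ≤ C * Real.exp (-δ * n)) :
    ∀ᵐ ω ∂P, Tendsto (fun n => Y n ω) atTop (𝓝 0) := by
  have hev : ∀ m : ℕ, ∀ᵐ ω ∂P, ∀ᶠ n in atTop, |Y n ω| ≤ 1 / ((m : ℝ) + 1) := fun m => by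
    obtain ⟨C, δ, hC, hδ, hb⟩ := h (1 / ((m : ℝ) + 1)) (by positivity)
    have hsum : Summable fun n : ℕ => C * Real.exp (-δ * n) := by
      refine Summable.mul_left C ?_
      simpa only [mul_comm] using Real.summable_exp_nat_mul_iff.2 (neg_lt_zero.2 hδ)
    -- The index is shifted because the tail bound is assumed only from `n = 1`.
    have hfin : ∑' n, P {ω | 1 / ((m : ℝ) + 1) < |Y (n + 1) ω|} ≠ ⊤ := by
      have hs := (summable_nat_add_iff 1).2 hsum
      refine ne_top_of_le_ne_top hs.tsum_ofReal_ne_top (ENNReal.tsum_le_tsum fun n => ?_)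
      rw [← ofReal_measureReal]
      exact ENNReal.ofReal_le_ofReal (hb (n + 1) (by omega))
    filter_upwards [ae_eventually_notMem hfin] with ω hω
    obtain ⟨n₀, hn₀⟩ := eventually_atTop.1 hω
    filter_upwards [eventually_ge_atTop (n₀ + 1)] with n hn
    have := hn₀ (n - 1) (by omega)
    rw [Nat.sub_add_cancel (by omega)] at this
    exact not_lt.1 this
  filter_upwards [ae_all_iff.2 hev] with ω hω
  refine Metric.tendsto_nhds.2 fun r hr => ?_
  obtain ⟨m, hm⟩ := exists_nat_one_div_lt hr
  filter_upwards [hω m] with n hn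
  rw [dist_zero_right]
  exact hn.trans_lt hm

end LargeDeviations

end NonstationaryWalk

theorem theorem1 {A : Type*} [AddCommGroup A] [TopologicalSpace A]
    [IsTopologicalAddGroup A] [CompactSpace A] [TopologicalSpace.MetrizableSpace A]
    [MeasurableSpace A] [BorelSpace A]
    (K : Set (ProbabilityMeasure A)) (hK : IsCompact K)
    (hK_ap : ∀ ν ∈ K, NonstationaryWalk.StrictlyAperiodic (ν : Measure A))
    (μ : ℕ → ProbabilityMeasure A) (hμ : ∀ j, μ j ∈ K) (φ : C(A, ℝ)) :
    (∀ (x : A) (Ω : Type*) [MeasurableSpace Ω] (P : Measure Ω) [IsProbabilityMeasure P]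
        (α : ℕ → Ω → A), (∀ j, Measurable (α j)) → (∀ j, P.map (α j) = (μ j : Measure A)) →
        iIndepFun α P →
        ∀ᵐ ω ∂P, Tendsto (fun n : ℕ => NonstationaryWalk.walkAverage φ x (fun j => α j ω) n)
          atTop (𝓝 (∫ y, φ y ∂(NonstationaryWalk.haarProb A)))) ∧
    (∀ ε : ℝ, 0 < ε → ∃ C δ : ℝ, 0 < C ∧ 0 < δ ∧ ∀ (x : A) (n : ℕ), 1 ≤ n →
        (Measure.infinitePi (fun j : ℕ => (μ j : Measure A))).real
          {a : ℕ → A | ε < |NonstationaryWalk.walkAverage φ x a n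
            - ∫ y, φ y ∂(NonstationaryWalk.haarProb A)|}
          < C * Real.exp (-δ * (n : ℝ))) := by
  have : SecondCountableTopology A := by
    let _ := TopologicalSpace.metrizableSpaceMetric A
    infer_instance
  refine ⟨fun x Ω _ P _ α hα hlaw hind => ?_, fun ε hε => ?_⟩
  · have h := NonstationaryWalk.ae_tendsto_of_exp_tail (P := P)
      (Y := fun n ω => NonstationaryWalk.walkAverage φ x (fun j => α j ω) n
        - ∫ y, φ y ∂(NonstationaryWalk.haarProb A)) fun ε hε => by
      obtain ⟨C, δ, hC, hδ, h⟩ :=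
        NonstationaryWalk.exists_exp_tail hK hK_ap hμ hα hlaw hind φ hε
      exact ⟨C, δ, hC, hδ, h x⟩
    filter_upwards [h] with ω hω
    exact tendsto_sub_nhds_zero_iff.1 hω
  · obtain ⟨C, δ, hC, hδ, h⟩ := NonstationaryWalk.exists_exp_tail
      (P := Measure.infinitePi fun j : ℕ => (μ j : Measure A)) (α := fun j a => a j)
      hK hK_ap hμ (fun j => measurable_pi_apply j) (fun j => Measure.infinitePi_map_eval _ j)
      (iIndepFun_infinitePi (X := fun _ a => a) fun _ => measurable_id) φ hε
    -- Enlarging the constant makes the inequality strict.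
    refine ⟨C + 1, δ, by linarith, hδ, fun x n hn => (h x n hn).trans_lt ?_⟩
    exact mul_lt_mul_of_pos_right (lt_add_one C) (Real.exp_pos _)
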